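/- Let $J,d_1,\dots,d_m\in\mathbb{R}[\theta,\alpha]$ be polynomials in $\theta\in\mathbb{R}^\ell$, $\alpha\in\mathbb{R}^T$. For $\theta\in\mathbb{R}^\ell$ put $$\mathcal S_{\alpha,\theta}=\{\alpha\in\mathbb{R}^T: d_\mu(\alpha,\theta)\ge 0,\ \mu=1,\dots,m\},\qquad \widetilde J(\theta)=\max_{\alpha\in\mathcal S_{\alpha,\theta}}J(\theta,\alpha).$$ Let $\mathcal M\subset\mathbb{R}^\ell$ be a nonempty compact set (for instance a compact semialgebraic set) such that every nonempty relatively open subset of $\mathcal M$ has positive Lebesgue measure, let $\mathcal R_\theta=\prod_{k=1}^{\ell}[\underline\theta_k,\overline\theta_k]$ be a box containing $\mathcal M$ (for instance the smallest one), let $\phi_k(\theta)=(\overline\theta_k-\theta_k)(\theta_k-\underline\theta_k)$ for $k=1,\dots,\ell$, and let $\varphi$ be the uniform probability measure on $\mathcal R_\theta$, with moments $\gamma_\beta=\int\theta^\beta\,d\varphi(\theta)$. Assume that $\mathcal S_{\alpha,\theta}\neq\emptyset$ for all $\theta\in\mathcal R_\theta$, and that the quadratic module generated by $d_1,\dots,d_m,\phi_1,\dots,\phi_\ell$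 in $\mathbb{R}[\theta,\alpha]$ is Archimedean, i.e. contains $N-\|\theta\|^2-\|\alpha\|^2$ for some $N\in\mathbb{R}$. For $\tau\in\mathbb{N}$ consider the semidefinite program: minimize $\sum_{|\beta|\le 2\tau}\lambda_\beta\gamma_\beta$ over real $(\lambda_\beta)_{|\beta|\le 2\tau}$ and sums of squares $\sigma_0,\dots,\sigma_m,\psi_1,\dots,\psi_\ell\in\mathbb{R}[\theta,\alpha]$ subject to $$\sum_{|\beta|\le 2\tau}\lambda_\beta\theta^\beta-J=\sigma_0+\sum_{\mu=1}^m\sigma_\mu d_\mu+\sum_{k=1}^{\ell}\psi_k\phi_k,\qquad \deg\sigma_0,\ \deg(\sigma_\mu d_\mu),\ \deg(\psi_k\phi_k)\le 2\tau .$$ Suppose that for every $\tau\ge\tau_0$ this program has an optimal solution; fix one, with polynomial $\widetilde J^*_\tau(\theta)=\sum_\beta\lambda^*_\beta\theta^\beta$. Let $J^*_\tau=\min_{\theta\in\mathcal M}\widetilde J^*_\tau(\theta)$ and $\widehat J_\tau=\min_{\tau_0\le k\le\tau}J^*_k$. Then the maxima defining $\widetilde J$ on $\mathcal R_\theta$ and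 the minima defining $J^*_\tau$ are attained, and $$\lim_{\tau\to\infty}\ \min_{\tau_0\le k\le\tau}J^*_k\;=\;J^*:=\inf_{\theta\in\mathcal M}\ \max_{\alpha\in\mathcal S_{\alpha,\theta}}J(\theta,\alpha)\in\mathbb{R}.$$ Moreover, let $\theta^*_\tau\in\mathcal M$ be any minimizer of $\widetilde J^*_\tau$ over $\mathcal M$ ($\tau\ge\tau_0$), and let $k(\tau)\in\{\tau_0,\dots,\tau\}$ be any index with $J^*_{k(\tau)}=\widehat J_\tau$. Then $\widetilde J^*_{k(\tau)}(\theta^*_{k(\tau)})\to J^*$ as $\tau\to\infty$. If $\widetilde J$ is continuous on $\mathcal M$, then every accumulation point of $(\theta^*_{k(\tau)})_\tau$ is a global minimizer of $\widetilde J$ on $\mathcal M$, and if in addition $\widetilde J$ has a unique global minimizer $\theta_{\rm rob}$ on $\mathcal M$, then $\theta^*_{k(\tau)}\to\theta_{\rm rob}$. -/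

import Mathlib

open Filter Topology MeasureTheory

noncomputable section

namespace RobustSM

/-- The inner feasible set `S_{α,θ} = {α ∈ ℝ^T : d_μ(α,θ) ≥ 0, μ = 1,…,m}`.
Polynomials in `(θ, α)` have their variables indexed by `Fin l ⊕ Fin T`. -/
def innerSet {l T m : ℕ} (d : Fin m → MvPolynomial (Fin l ⊕ Fin T) ℝ) (θ : Fin l → ℝ) :
    Set (Fin T → ℝ) :=
  {α | ∀ μ, 0 ≤ MvPolynomial.eval (Sum.elim θ α) (d μ)}

/-- The values `J(θ,α)`, `α ∈ S_{α,θ}`, of the inner maximization problem at `θ`. -/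
def innerValues {l T m : ℕ} (J : MvPolynomial (Fin l ⊕ Fin T) ℝ)
    (d : Fin m → MvPolynomial (Fin l ⊕ Fin T) ℝ) (θ : Fin l → ℝ) : Set ℝ :=
  (fun α => MvPolynomial.eval (Sum.elim θ α) J) '' innerSet d θ

/-- The optimal value function `J̃(θ) = max_{α ∈ S_{α,θ}} J(θ,α)`. -/
def valueFn {l T m : ℕ} (J : MvPolynomial (Fin l ⊕ Fin T) ℝ)
    (d : Fin m → MvPolynomial (Fin l ⊕ Fin T) ℝ) (θ : Fin l → ℝ) : ℝ :=
  sSup (innerValues J d θ)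

/-- The optimal value of the minimization of `f` over `A`. -/
def optValue {l : ℕ} (A : Set (Fin l → ℝ)) (f : (Fin l → ℝ) → ℝ) : ℝ :=
  sInf (f '' A)

/-- The set of global minimizers of `f` over `A`. -/
def minimizers {l : ℕ} (A : Set (Fin l → ℝ)) (f : (Fin l → ℝ) → ℝ) : Set (Fin l → ℝ) :=
  {θ | θ ∈ A ∧ ∀ θ' ∈ A, f θ ≤ f θ'}

/-- The polynomial `φ_k(θ) = (hi_k - θ_k)(θ_k - lo_k)`, seen in `ℝ[θ, α]`. -/
def boxPoly {l T : ℕ} (lo hi : Fin l → ℝ) (k : Fin l) : MvPolynomial (Fin l ⊕ Fin T) ℝ :=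
  (MvPolynomial.C (hi k) - MvPolynomial.X (Sum.inl k)) *
    (MvPolynomial.X (Sum.inl k) - MvPolynomial.C (lo k))

/-- The uniform probability measure on the box `[lo, hi]`. -/
def uniformBox {l : ℕ} (lo hi : Fin l → ℝ) : Measure (Fin l → ℝ) :=
  ProbabilityTheory.cond volume (Set.Icc lo hi)

/-- The moment `γ_β = ∫ θ^β dφ(θ)` of the uniform probability measure on the box. -/
def boxMoment {l : ℕ} (lo hi : Fin l → ℝ) (β : Fin l →₀ ℕ) : ℝ :=
  ∫ θ, ∏ k, θ k ^ β k ∂(uniformBox lo hi)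

/-- `f = σ₀ + ∑ σ_μ d_μ + ∑ ψ_k φ_k` with `σ₀`, `σ_μ`, `ψ_k` sums of squares in `ℝ[θ, α]`. -/
def IsCertificate {l T m : ℕ} (d : Fin m → MvPolynomial (Fin l ⊕ Fin T) ℝ) (lo hi : Fin l → ℝ)
    (f σ₀ : MvPolynomial (Fin l ⊕ Fin T) ℝ) (σ : Fin m → MvPolynomial (Fin l ⊕ Fin T) ℝ)
    (ψ : Fin l → MvPolynomial (Fin l ⊕ Fin T) ℝ) : Prop :=
  IsSumSq σ₀ ∧ (∀ μ, IsSumSq (σ μ)) ∧ (∀ k, IsSumSq (ψ k)) ∧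
    f = σ₀ + ∑ μ, σ μ * d μ + ∑ k, ψ k * boxPoly lo hi k

/-- The quadratic module generated by the `d_μ` and the `φ_k` is Archimedean. -/
def IsArchimedeanModule {l T m : ℕ} (d : Fin m → MvPolynomial (Fin l ⊕ Fin T) ℝ)
    (lo hi : Fin l → ℝ) : Prop :=
  ∃ (N : ℝ) (σ₀ : MvPolynomial (Fin l ⊕ Fin T) ℝ)
    (σ : Fin m → MvPolynomial (Fin l ⊕ Fin T) ℝ)
    (ψ : Fin l → MvPolynomial (Fin l ⊕ Fin T) ℝ),
    IsCertificate d lo hi (MvPolynomial.C N - ∑ i, MvPolynomial.X i ^ 2) σ₀ σ ψ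

/-- Feasibility of `p(θ) = ∑_β λ_β θ^β` in the semidefinite relaxation of order `τ`. -/
def IsFeasible {l T m : ℕ} (J : MvPolynomial (Fin l ⊕ Fin T) ℝ)
    (d : Fin m → MvPolynomial (Fin l ⊕ Fin T) ℝ) (lo hi : Fin l → ℝ) (τ : ℕ)
    (p : MvPolynomial (Fin l) ℝ) : Prop :=
  p.totalDegree ≤ 2 * τ ∧
    ∃ (σ₀ : MvPolynomial (Fin l ⊕ Fin T) ℝ)
      (σ : Fin m → MvPolynomial (Fin l ⊕ Fin T) ℝ)
      (ψ : Fin l → MvPolynomial (Fin l ⊕ Fin T) ℝ),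
      IsCertificate d lo hi (MvPolynomial.rename Sum.inl p - J) σ₀ σ ψ ∧
      σ₀.totalDegree ≤ 2 * τ ∧
      (∀ μ, (σ μ * d μ).totalDegree ≤ 2 * τ) ∧
      (∀ k, (ψ k * boxPoly lo hi k).totalDegree ≤ 2 * τ)

/-- The objective `∑_β λ_β γ_β` of the semidefinite relaxation. -/
def objective {l : ℕ} (lo hi : Fin l → ℝ) (p : MvPolynomial (Fin l) ℝ) : ℝ :=
  ∑ β ∈ p.support, p.coeff β * boxMoment lo hi β

/-- `p` is (the polynomial part of) an optimal solution of the relaxation of order `τ`. -/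
def IsOptimal {l T m : ℕ} (J : MvPolynomial (Fin l ⊕ Fin T) ℝ)
    (d : Fin m → MvPolynomial (Fin l ⊕ Fin T) ℝ) (lo hi : Fin l → ℝ) (τ : ℕ)
    (p : MvPolynomial (Fin l) ℝ) : Prop :=
  IsFeasible J d lo hi τ p ∧
    ∀ q, IsFeasible J d lo hi τ q → objective lo hi p ≤ objective lo hi q

/-- The optimal value `J*_τ` of the minimization over `A` of the polynomial `P τ`. -/
def polyOptValue {l : ℕ} (A : Set (Fin l → ℝ)) (P : ℕ → MvPolynomial (Fin l) ℝ) (τ : ℕ) : ℝ :=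
  optValue A (fun θ => MvPolynomial.eval θ (P τ))

/-- The best value so far, `min_{τ₀ ≤ k ≤ τ} J*_k`. -/
def bestValue {l : ℕ} (A : Set (Fin l → ℝ)) (P : ℕ → MvPolynomial (Fin l) ℝ) (τ₀ τ : ℕ) : ℝ :=
  sInf (polyOptValue A P '' Set.Icc τ₀ τ)

end RobustSM

end

/-! A feasible polynomial majorizes J̃ on the box, so every J*_τ is at least J*, and its objective
is its mean over the box. Suppose J*_k ≥ J* + ε for all k ≥ τ₀. Near some θ₀ in M, J̃ stays below c
= J* + ε/2 by upper semicontinuity, while every optimal polynomial is at least c + ε/2 on M, which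
has positive measure near θ₀. A bump at θ₀ therefore lowers each of them to a continuous majorant
whose mean drops by a δ independent of k (`exists_forall_exists_lower_majorant`). Weierstrass
approximation and Putinar's theorem make that majorant feasible at a higher order, which contradicts
the choice of k within δ/2 of the infimum of the optimal values. The means need not be shown to
converge to the mean of J̃.

Putinar's theorem (`mem_of_forall_algHom_pos`) comes from convexity: an element outside an
Archimedean module is nonpositive at some state, the states form a compact set, and extreme states
are multiplicative, hence point evaluations. -/

noncomputable section

/-! ### Archimedean quadratic modules and their states -/

namespace QuadraticModule

variable {A : Type*} [CommRing A] [Algebra ℝ A]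

/-- A quadratic module of an `ℝ`-algebra. -/
structure IsQuadraticModule (Q : Set A) : Prop where
  one_mem : 1 ∈ Q
  add_mem : ∀ {a b}, a ∈ Q → b ∈ Q → a + b ∈ Q
  sq_mul_mem : ∀ (a : A) {b}, b ∈ Q → a * a * b ∈ Q

/-- A quadratic module is Archimedean when every `a ^ 2` is bounded by a constant. -/
def IsArchimedean (Q : Set A) : Prop :=
  ∀ a : A, ∃ N : ℝ, algebraMap ℝ A N - a * a ∈ Q

/-- Normalized linear functionals that are nonnegative on `Q`. -/
structure IsState (Q : Set A) (L : A →ₗ[ℝ] ℝ) : Prop where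
  map_one : L 1 = 1
  nonneg : ∀ q ∈ Q, 0 ≤ L q

namespace IsQuadraticModule

variable {Q : Set A} (hQ : IsQuadraticModule Q)
include hQ

omit [Algebra ℝ A] in
theorem sq_mem (a : A) : a * a ∈ Q := by simpa using hQ.sq_mul_mem a hQ.one_mem

omit [Algebra ℝ A] in
theorem zero_mem : (0 : A) ∈ Q := by simpa using hQ.sq_mem 0

theorem smul_mem {c : ℝ} (hc : 0 ≤ c) {q : A} (hq : q ∈ Q) : c • q ∈ Q := by
  have h := hQ.sq_mul_mem (algebraMap ℝ A (Real.sqrt c)) hq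
  rwa [← map_mul, Real.mul_self_sqrt hc, ← Algebra.smul_def] at h

theorem algebraMap_mem {c : ℝ} (hc : 0 ≤ c) : algebraMap ℝ A c ∈ Q := by
  simpa [Algebra.algebraMap_eq_smul_one] using hQ.smul_mem hc hQ.one_mem

/-- The elements with bounded square are closed under addition. -/
theorem bounded_add {a b : A} (ha : ∃ N : ℝ, algebraMap ℝ A N - a * a ∈ Q)
    (hb : ∃ N : ℝ, algebraMap ℝ A N - b * b ∈ Q) :
    ∃ N : ℝ, algebraMap ℝ A N - (a + b) * (a + b) ∈ Q := by
  obtain ⟨N, hN⟩ := ha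
  obtain ⟨K, hK⟩ := hb
  -- Parallelogram identity: (a + b)² + (a - b)² = 2a² + 2b².
  refine ⟨N + N + (K + K), ?_⟩
  have := hQ.add_mem (hQ.add_mem (hQ.add_mem hN hN) (hQ.add_mem hK hK)) (hQ.sq_mem (a - b))
  convert this using 1
  simp only [map_add]
  ring

/-- The elements with bounded square are closed under multiplication. -/
theorem bounded_mul {a b : A} (ha : ∃ N : ℝ, algebraMap ℝ A N - a * a ∈ Q)
    (hb : ∃ N : ℝ, algebraMap ℝ A N - b * b ∈ Q) :
    ∃ N : ℝ, algebraMap ℝ A N - (a * b) * (a * b) ∈ Q := by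
  obtain ⟨N, hN⟩ := ha
  obtain ⟨K, hK⟩ := hb
  refine ⟨max N 0 * K, ?_⟩
  have hN' : algebraMap ℝ A (max N 0) - a * a ∈ Q := by
    convert hQ.add_mem hN (hQ.algebraMap_mem (c := max N 0 - N) (by simp)) using 1
    simp only [map_sub]
    ring
  by_cases hK0 : 0 ≤ K
  · convert hQ.add_mem (hQ.smul_mem hK0 hN') (hQ.sq_mul_mem a hK) using 1
    rw [Algebra.smul_def, map_mul]
    ring
  · convert hQ.add_mem (hQ.smul_mem (le_max_right N 0) hK)
      (hQ.sq_mul_mem b hN') using 1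
    rw [Algebra.smul_def, map_mul]
    ring

theorem bounded_algebraMap (c : ℝ) :
    ∃ N : ℝ, algebraMap ℝ A N - algebraMap ℝ A c * algebraMap ℝ A c ∈ Q :=
  ⟨c * c, by simpa using hQ.zero_mem⟩

/-- 4f = (f + 1)² - (f - 1)². -/
theorem eq_univ_of_neg_one_mem (h : (-1 : A) ∈ Q) (f : A) : f ∈ Q := by
  have h2 := hQ.add_mem (hQ.sq_mem (f + 1)) (hQ.sq_mul_mem (f - 1) h)
  have h3 := hQ.smul_mem (c := 1 / 4) (by norm_num) h2
  convert h3 using 1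
  have : (f + 1) * (f + 1) + (f - 1) * (f - 1) * -1 = (4 : ℝ) • f := by
    rw [Algebra.smul_def, map_ofNat]
    ring
  rw [this, smul_smul]
  norm_num

end IsQuadraticModule

/-- Only positivity on squares is required, so this also covers the twisted functionals L(g ·) with
g ∈ Q. -/
theorem cauchy_schwarz {L : A →ₗ[ℝ] ℝ} (hL : ∀ a, 0 ≤ L (a * a)) (a b : A) :
    L (a * b) ^ 2 ≤ L (a * a) * L (b * b) := by
  have h : ∀ t : ℝ, 0 ≤ L (b * b) * (t * t) + 2 * L (a * b) * t + L (a * a) := by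
    intro t
    have h1 := hL (a + t • b)
    have h2 : (a + t • b) * (a + t • b) = (t * t) • (b * b) + (2 * t) • (a * b) + a * a := by
      simp only [Algebra.smul_def, map_mul, map_ofNat]
      ring
    rw [h2] at h1
    simp only [map_add, map_smul, smul_eq_mul] at h1
    linarith
  have := discrim_le_zero h
  rw [discrim] at this
  nlinarith

/-- A log-convex sequence with geometric growth of ratio `N` starts with ratio at most `N`. -/
theorem le_mul_of_logConvex {u : ℕ → ℝ} {C N : ℝ} (hN : 0 < N) (hu : ∀ n, 0 ≤ u n)
    (hlog : ∀ n, u (n + 1) ^ 2 ≤ u n * u (n + 2)) (hgrow : ∀ n, u n ≤ C * N ^ n) :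
    u 1 ≤ N * u 0 := by
  by_contra! h
  have h0 : 0 < u 0 := by
    refine (hu 0).lt_of_ne fun h0 => ?_
    have := hlog 0
    simp only [← h0, zero_mul, mul_zero, zero_add] at this h
    nlinarith
  set r := u 1 / u 0 with hr
  have hrN : N < r := by rwa [hr, lt_div_iff₀ h0]
  have hr0 : 0 < r := hN.trans hrN
  -- Log-convexity makes the ratios nondecreasing, so `u n` dominates `r ^ n * u 0`, which outgrows
  -- `C * N ^ n`.
  have step : ∀ n, 0 < u n ∧ r * u n ≤ u (n + 1) := by
    intro n
    induction n with
    | zero => exact ⟨h0, by rw [hr]; field_simp; rfl⟩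
    | succ n ih =>
      have h1 : 0 < u (n + 1) := lt_of_lt_of_le (mul_pos hr0 ih.1) ih.2
      refine ⟨h1, ?_⟩
      have h3 : u n * (r * u (n + 1)) ≤ u n * u (n + 2) := by
        have := hlog n
        nlinarith [mul_le_mul_of_nonneg_right ih.2 h1.le]
      exact le_of_mul_le_mul_left h3 ih.1
  have hpow : ∀ n, r ^ n * u 0 ≤ u n := by
    intro n
    induction n with
    | zero => simp
    | succ n ih =>
      calc r ^ (n + 1) * u 0 = r * (r ^ n * u 0) := by ring
        _ ≤ r * u n := by gcongr
        _ ≤ _ := (step n).2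
  have hlim := tendsto_pow_atTop_atTop_of_one_lt ((one_lt_div hN).2 hrN)
  obtain ⟨n, hn⟩ := (hlim.eventually_gt_atTop (C / u 0)).exists
  rw [div_pow, div_lt_div_iff₀ h0 (pow_pos hN n)] at hn
  linarith [hpow n, hgrow n]

namespace IsState

variable {Q : Set A} {L : A →ₗ[ℝ] ℝ}

theorem map_algebraMap (hL : IsState Q L) (c : ℝ) : L (algebraMap ℝ A c) = c := by
  rw [Algebra.algebraMap_eq_smul_one, map_smul, hL.map_one, smul_eq_mul, mul_one]

theorem sq_nonneg (hL : IsState Q L) (hQ : IsQuadraticModule Q) (a : A) : 0 ≤ L (a * a) :=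
  hL.nonneg _ (hQ.sq_mem a)

theorem map_pow_le (hL : IsState Q L) (hQ : IsQuadraticModule Q) {a : A} {N : ℝ} (hN : 0 < N)
    (ha : algebraMap ℝ A N - a * a ∈ Q) (n : ℕ) : L (a ^ n * a ^ n) ≤ N ^ n := by
  induction n with
  | zero => simp [hL.map_one]
  | succ n ih =>
    have h := hL.nonneg _ (hQ.sq_mul_mem (a ^ n) ha)
    have e : a ^ n * a ^ n * (algebraMap ℝ A N - a * a) =
        N • (a ^ n * a ^ n) - a ^ (n + 1) * a ^ (n + 1) := by
      rw [Algebra.smul_def]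
      ring
    rw [e, map_sub, map_smul, smul_eq_mul] at h
    calc L (a ^ (n + 1) * a ^ (n + 1)) ≤ N * L (a ^ n * a ^ n) := by linarith
      _ ≤ N * N ^ n := by gcongr
      _ = N ^ (n + 1) := by ring

/-- Multiplication by `N - a ^ 2 ∈ Q` preserves nonnegativity of a state on `Q`. -/
theorem mul_nonneg (hL : IsState Q L) (hQ : IsQuadraticModule Q) {a : A} {N : ℝ} (hN : 0 < N)
    (ha : algebraMap ℝ A N - a * a ∈ Q) {g : A} (hg : g ∈ Q) :
    0 ≤ L ((algebraMap ℝ A N - a * a) * g) := by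
  have hLg : ∀ b, 0 ≤ (L ∘ₗ LinearMap.mulLeft ℝ g) (b * b) := fun b => by
    simpa [mul_comm g] using hL.nonneg _ (hQ.sq_mul_mem b hg)
  -- The product need not lie in Q. The moments L(g a²ⁿ) are log-convex by Cauchy–Schwarz for L(g
  -- ·), and bounded by √L(g²) Nⁿ by Cauchy–Schwarz for L, so their first ratio is at most N.
  have key : L (g * (a ^ 1 * a ^ 1)) ≤ N * L (g * (a ^ 0 * a ^ 0)) := by
    refine le_mul_of_logConvex (u := fun n => L (g * (a ^ n * a ^ n)))
      (C := Real.sqrt (L (g * g))) hN (fun n => hLg (a ^ n)) (fun n => ?_) (fun n => ?_)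
    · have := cauchy_schwarz hLg (a ^ n) (a ^ (n + 2))
      simp only [LinearMap.coe_comp, Function.comp_apply, LinearMap.mulLeft_apply] at this
      convert this using 4
      ring
    · refine le_of_sq_le_sq ?_ (by positivity)
      have h1 := cauchy_schwarz (hL.sq_nonneg hQ) g (a ^ n * a ^ n)
      have h2 := hL.map_pow_le hQ hN ha (2 * n)
      have e : a ^ n * a ^ n * (a ^ n * a ^ n) = a ^ (2 * n) * a ^ (2 * n) := by ring
      rw [e] at h1
      rw [mul_pow, Real.sq_sqrt (hL.sq_nonneg hQ g), ← pow_mul, mul_comm n]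
      exact h1.trans (mul_le_mul_of_nonneg_left h2 (hL.sq_nonneg hQ g))
  have e : (algebraMap ℝ A N - a * a) * g =
      N • (g * (a ^ 0 * a ^ 0)) - g * (a ^ 1 * a ^ 1) := by
    rw [Algebra.smul_def]
    ring
  rw [e, map_sub, map_smul, smul_eq_mul]
  linarith

end IsState

/-- The states of `Q`, as a set of functions. -/
def stateSpace (Q : Set A) : Set (A → ℝ) := {F | ∃ L : A →ₗ[ℝ] ℝ, IsState Q L ∧ ⇑L = F}

/-- Tychonoff: L(a)² ≤ L(a²) ≤ N(a) confines each coordinate, and linearity, normalization and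
positivity are closed conditions. -/
theorem isCompact_stateSpace {Q : Set A} (hQ : IsQuadraticModule Q) (hA : IsArchimedean Q) :
    IsCompact (stateSpace Q) := by
  choose N hN using hA
  have hc : IsCompact (Set.univ.pi fun a : A => Set.Icc (-Real.sqrt (N a)) (Real.sqrt (N a))) :=
    isCompact_univ_pi fun a => isCompact_Icc
  refine hc.of_isClosed_subset ?_ ?_
  · have : stateSpace Q = Set.range ((⇑) : (A →ₗ[ℝ] ℝ) → A → ℝ) ∩
        ({F | F 1 = 1} ∩ ⋂ q ∈ Q, {F | 0 ≤ F q}) := by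
      ext F
      simp only [stateSpace, Set.mem_ofPred_eq, Set.mem_inter_iff, Set.mem_range, Set.mem_iInter]
      constructor
      · rintro ⟨L, h, rfl⟩
        exact ⟨⟨L, rfl⟩, h.map_one, h.nonneg⟩
      · rintro ⟨⟨L, rfl⟩, h1, h2⟩
        exact ⟨L, ⟨h1, h2⟩, rfl⟩
    rw [this]
    refine (LinearMap.isClosed_range_coe A ℝ (RingHom.id ℝ)).inter
      ((isClosed_eq (continuous_apply 1) continuous_const).inter ?_)
    exact isClosed_biInter fun q _ => isClosed_le continuous_const (continuous_apply q)
  · rintro _ ⟨L, hL, rfl⟩ a -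
    refine abs_le.1 (?_ : |L a| ≤ Real.sqrt (N a))
    refine Real.abs_le_sqrt ?_
    have h1 := cauchy_schwarz (hL.sq_nonneg hQ) a 1
    have h2 := hL.nonneg _ (hN a)
    rw [map_sub, hL.map_algebraMap] at h2
    simp only [mul_one, hL.map_one] at h1
    linarith

/-- Extreme states are multiplicative. -/
theorem map_mul_of_extreme {Q : Set A} (hQ : IsQuadraticModule Q) (hA : IsArchimedean Q)
    {L : A →ₗ[ℝ] ℝ} (hL : IsState Q L) (hext : ⇑L ∈ (stateSpace Q).extremePoints ℝ) (a b : A) :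
    L (a * b) = L a * L b := by
  have hsq : ∀ a g : A, L (a * a * g) = L (a * a) * L g := by
    intro a g
    obtain ⟨N, hN⟩ := hA a
    have hN0 : 0 ≤ N := by
      have h := hL.nonneg _ hN
      rw [map_sub, hL.map_algebraMap] at h
      linarith [hL.sq_nonneg hQ a]
    have hN1 : algebraMap ℝ A (N + 1) - a * a ∈ Q := by
      convert hQ.add_mem hN hQ.one_mem using 1
      rw [map_add, _root_.map_one]
      ring
    set s := L (a * a) with hs
    have hs0 : 0 ≤ s := hL.sq_nonneg hQ a
    have hsN : s < N + 1 := by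
      have h := hL.nonneg _ hN
      rw [map_sub, hL.map_algebraMap] at h
      linarith
    -- L is a proper convex combination of these two states, the normalizations of L((1 + a²) ·) and
    -- L((N + 1 - a²) ·). Extremality forces L = L₁, which is the identity sought. The added 1's
    -- keep both normalizing constants positive.
    let L₁ : A →ₗ[ℝ] ℝ := (1 + s)⁻¹ • (L ∘ₗ LinearMap.mulLeft ℝ (1 + a * a))
    let L₂ : A →ₗ[ℝ] ℝ :=
      (N + 1 - s)⁻¹ • (L ∘ₗ LinearMap.mulLeft ℝ (algebraMap ℝ A (N + 1) - a * a))
    have hL₁ : IsState Q L₁ := by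
      refine ⟨?_, fun q hq => ?_⟩
      · simp [L₁, hL.map_one, ← hs, (by positivity : 1 + s ≠ 0)]
      · simp only [L₁, LinearMap.smul_apply, LinearMap.comp_apply, LinearMap.mulLeft_apply,
          smul_eq_mul, add_mul, one_mul, map_add]
        have h1 := hL.nonneg _ hq
        have h2 := hL.nonneg _ (hQ.sq_mul_mem a hq)
        positivity
    have hL₂ : IsState Q L₂ := by
      refine ⟨?_, fun q hq => ?_⟩
      · simp only [L₂, LinearMap.smul_apply, LinearMap.comp_apply, LinearMap.mulLeft_apply,
          smul_eq_mul, mul_one, map_sub, hL.map_algebraMap, ← hs]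
        exact inv_mul_cancel₀ (by linarith)
      · exact _root_.mul_nonneg (inv_nonneg.2 (by linarith))
          (hL.mul_nonneg hQ (by linarith) hN1 hq)
    have hseg : ⇑L ∈ openSegment ℝ ⇑L₁ ⇑L₂ := by
      refine ⟨(1 + s) / (N + 2), (N + 1 - s) / (N + 2), by positivity,
        div_pos (by linarith) (by linarith), by field_simp; ring, ?_⟩
      ext g
      have h1 : 1 + s ≠ 0 := by positivity
      have h2 : N + 1 - s ≠ 0 := by linarith
      simp only [L₁, L₂, Pi.add_apply, Pi.smul_apply, LinearMap.smul_apply, LinearMap.comp_apply,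
        LinearMap.mulLeft_apply, smul_eq_mul]
      have e : L ((1 + a * a) * g) + L ((algebraMap ℝ A (N + 1) - a * a) * g) = (N + 2) * L g := by
        rw [← map_add, ← add_mul, add_add_sub_cancel, add_mul, one_mul, ← Algebra.smul_def,
          map_add, map_smul, smul_eq_mul]
        ring
      field_simp
      linarith
    have h := congrFun (hext.2 ⟨L₁, hL₁, rfl⟩ ⟨L₂, hL₂, rfl⟩ hseg) g
    simp only [L₁, LinearMap.smul_apply, LinearMap.comp_apply,
      LinearMap.mulLeft_apply, smul_eq_mul, add_mul, one_mul, map_add] at h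
    rw [inv_mul_eq_iff_eq_mul₀ (by positivity)] at h
    linarith
  -- Replacing a by a + 1 polarizes the identity for squares.
  have h1 := hsq (a + 1) b
  have h2 := hsq a b
  have h3 : (a + 1) * (a + 1) * b = a * a * b + (2 : ℝ) • (a * b) + b := by
    rw [Algebra.smul_def, map_ofNat]
    ring
  have h4 : (a + 1) * (a + 1) = a * a + (2 : ℝ) • a + 1 := by
    rw [Algebra.smul_def, map_ofNat]
    ring
  rw [h3, h4] at h1
  simp only [map_add, map_smul, smul_eq_mul, hL.map_one] at h1
  linarith

/-- An element outside an Archimedean quadratic module is nonpositive at some state. -/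
theorem exists_state_nonpos {Q : Set A} (hQ : IsQuadraticModule Q) (hA : IsArchimedean Q) {f : A}
    (hf : f ∉ Q) : ∃ L : A →ₗ[ℝ] ℝ, IsState Q L ∧ L f ≤ 0 := by
  have hneg : (-1 : A) ∉ Q := fun h => hf (hQ.eq_univ_of_neg_one_mem h f)
  -- The cone Q - ℝ≥0 f omits -1, since -1 = q - t f with t > 0 would put f = t⁻¹(q + 1) in Q. A
  -- functional nonnegative on this cone is nonnegative on Q and nonpositive at f.
  let s : PointedCone ℝ A :=
    { carrier := {x | ∃ q ∈ Q, ∃ t : ℝ, 0 ≤ t ∧ x = q - t • f}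
      add_mem' := by
        rintro _ _ ⟨q, hq, t, ht, rfl⟩ ⟨q', hq', t', ht', rfl⟩
        exact ⟨q + q', hQ.add_mem hq hq', t + t', add_nonneg ht ht', by rw [add_smul]; abel⟩
      zero_mem' := ⟨0, hQ.zero_mem, 0, le_rfl, by simp⟩
      smul_mem' := by
        rintro ⟨c, hc⟩ _ ⟨q, hq, t, ht, rfl⟩
        exact ⟨c • q, hQ.smul_mem hc hq, c * t, mul_nonneg hc ht, by
          rw [Nonneg.mk_smul, smul_sub, smul_smul]⟩ }
  have hs : ∀ x, x ∈ s ↔ ∃ q ∈ Q, ∃ t : ℝ, 0 ≤ t ∧ x = q - t • f := fun x => Iff.rfl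
  have hone : (1 : A) ≠ 0 := fun h => hneg (by
    rw [h, neg_zero]
    exact hQ.zero_mem)
  have hnegs : (-1 : A) ∉ s := by
    rw [hs]
    rintro ⟨q, hq, t, ht, h⟩
    rcases ht.eq_or_lt with rfl | ht
    · apply hneg
      rw [h]
      simpa using hq
    · apply hf
      have h1 := hQ.smul_mem (inv_nonneg.2 ht.le) (hQ.add_mem hq hQ.one_mem)
      have h2 : q + 1 = t • f := by
        have : t • f = q - -1 := by rw [h]; abel
        rw [this]
        abel
      rwa [h2, inv_smul_smul₀ ht.ne'] at h1
  let φ : A →ₗ.[ℝ] ℝ := LinearPMap.mkSpanSingleton (1 : A) (1 : ℝ) hone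
  obtain ⟨L, hL1, hL2⟩ := riesz_extension s φ (by
    rintro ⟨x, hx⟩ hxs
    obtain ⟨c, rfl⟩ := Submodule.mem_span_singleton.1 hx
    have e : φ ⟨c • (1 : A), hx⟩ = c := by
      exact (LinearPMap.mkSpanSingleton'_apply _ _ _ c hx).trans (mul_one c)
    rw [e]
    by_contra! hc
    apply hnegs
    have h1 := s.smul_mem (inv_nonneg.2 (by linarith : 0 ≤ -c)) hxs
    convert h1 using 1
    rw [smul_smul, inv_neg, neg_mul, inv_mul_cancel₀ hc.ne, neg_smul, one_smul]) (by
    intro y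
    -- Riesz extension needs the line ℝ·1 to be cofinal: N + 1 + y = (N - (y - 1/2)²) + y² + 5/4.
    obtain ⟨N, hN⟩ := hA (y - algebraMap ℝ A (1 / 2))
    refine ⟨⟨(N + 1) • (1 : A), Submodule.smul_mem _ _ (Submodule.mem_span_singleton_self _)⟩, ?_⟩
    rw [hs]
    have h2 : algebraMap ℝ A (1 / 2) * 2 = 1 := by
      rw [← map_ofNat (algebraMap ℝ A) 2, ← map_mul]
      norm_num
    refine ⟨algebraMap ℝ A N - (y - algebraMap ℝ A (1 / 2)) * (y - algebraMap ℝ A (1 / 2)) + y * y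
      + (1 + algebraMap ℝ A (1 / 4)), hQ.add_mem (hQ.add_mem hN (hQ.sq_mem y)) ?_, 0, le_rfl, ?_⟩
    · rw [← map_one (algebraMap ℝ A), ← map_add]
      exact hQ.algebraMap_mem (by norm_num)
    · have h3 : algebraMap ℝ A (1 / 2) * algebraMap ℝ A (1 / 2) = algebraMap ℝ A (1 / 4) := by
        rw [← map_mul]
        norm_num
      change (N + 1) • (1 : A) + y = _
      rw [zero_smul, Algebra.smul_def, map_add, map_one]
      linear_combination h3 - y * h2)
  refine ⟨L, ⟨?_, fun q hq => hL2 _ ⟨q, hq, 0, le_rfl, by simp⟩⟩, ?_⟩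
  · have := hL1 ⟨1, Submodule.mem_span_singleton_self _⟩
    rw [this]
    exact LinearPMap.mkSpanSingleton_apply ℝ ℝ hone 1
  · have := hL2 (-f) ⟨0, hQ.zero_mem, 1, zero_le_one, by simp⟩
    rw [map_neg] at this
    linarith

/-- The representation theorem of Putinar and Jacobi: an element that is positive at every
character nonnegative on an Archimedean quadratic module belongs to the module. -/
theorem mem_of_forall_algHom_pos {Q : Set A} (hQ : IsQuadraticModule Q) (hA : IsArchimedean Q)
    {f : A} (hf : ∀ φ : A →ₐ[ℝ] ℝ, (∀ q ∈ Q, 0 ≤ φ q) → 0 < φ f) : f ∈ Q := by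
  by_contra hfQ
  obtain ⟨L₀, hL₀, hL₀f⟩ := exists_state_nonpos hQ hA hfQ
  have hcpt := isCompact_stateSpace hQ hA
  -- Minimizing the value at f exposes a face, hence the sign. Its extreme points are extreme
  -- states.
  let ev : StrongDual ℝ (A → ℝ) := -(ContinuousLinearMap.proj (R := ℝ) (φ := fun _ : A => ℝ) f)
  have hexp : IsExposed ℝ (stateSpace Q) (ev.toExposed (stateSpace Q)) :=
    ContinuousLinearMap.toExposed.isExposed
  obtain ⟨F, hF, hFmin⟩ := hcpt.exists_isMinOn ⟨_, L₀, hL₀, rfl⟩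
    (continuous_apply (A := fun _ : A => ℝ) f).continuousOn
  have hne : (ev.toExposed (stateSpace Q)).Nonempty :=
    ⟨F, hF, fun G hG => by simpa [ev] using hFmin hG⟩
  obtain ⟨G, hG⟩ := (hexp.isCompact hcpt).extremePoints_nonempty hne
  have hGext := hexp.isExtreme.extremePoints_subset_extremePoints hG
  obtain ⟨L, hL, rfl⟩ := hGext.1
  have hle : L f ≤ L₀ f := by simpa [ev] using hG.1.2 _ ⟨L₀, hL₀, rfl⟩
  have hpos := hf (AlgHom.ofLinearMap L hL.map_one (map_mul_of_extreme hQ hA hL hGext)) hL.nonneg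
  simp only [AlgHom.ofLinearMap_apply] at hpos
  linarith

end QuadraticModule

end

noncomputable section

/-! ### Putinar's theorem for the feasible pairs -/

namespace RobustSM

variable {l T m : ℕ} {J : MvPolynomial (Fin l ⊕ Fin T) ℝ}
  {d : Fin m → MvPolynomial (Fin l ⊕ Fin T) ℝ} {lo hi : Fin l → ℝ}

/-- The quadratic module generated by the `d_μ` and the `φ_k`. -/
def certModule (d : Fin m → MvPolynomial (Fin l ⊕ Fin T) ℝ) (lo hi : Fin l → ℝ) :
    Set (MvPolynomial (Fin l ⊕ Fin T) ℝ) :=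
  {f | ∃ σ₀ σ ψ, IsCertificate d lo hi f σ₀ σ ψ}

theorem isQuadraticModule_certModule (d : Fin m → MvPolynomial (Fin l ⊕ Fin T) ℝ)
    (lo hi : Fin l → ℝ) : QuadraticModule.IsQuadraticModule (certModule d lo hi) where
  one_mem := ⟨1, 0, 0, IsSumSq.one, fun _ => .zero, fun _ => .zero, by simp⟩
  add_mem := by
    rintro _ _ ⟨s, σ, ψ, h1, h2, h3, rfl⟩ ⟨s', σ', ψ', h1', h2', h3', rfl⟩
    refine ⟨s + s', σ + σ', ψ + ψ', h1.add h1', fun i => (h2 i).add (h2' i),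
      fun i => (h3 i).add (h3' i), ?_⟩
    simp only [Pi.add_apply, add_mul, Finset.sum_add_distrib]
    ring
  sq_mul_mem := by
    rintro a _ ⟨s, σ, ψ, h1, h2, h3, rfl⟩
    have ha : IsSumSq (a * a) := (IsSquare.mul_self a).isSumSq
    refine ⟨a * a * s, fun i => a * a * σ i, fun i => a * a * ψ i, ha.mul h1,
      fun i => ha.mul (h2 i), fun i => ha.mul (h3 i), ?_⟩
    simp only [mul_add, Finset.mul_sum, mul_assoc]

/-- Elements with bounded square form a subalgebra, so the variables suffice: N - Xᵢ² is N - ∑ Xⱼ²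
plus the other squares. -/
theorem certModule_isArchimedean (h : IsArchimedeanModule d lo hi) :
    QuadraticModule.IsArchimedean (certModule d lo hi) := by
  have hQ := isQuadraticModule_certModule d lo hi
  intro p
  induction p using MvPolynomial.induction_on with
  | C c => exact hQ.bounded_algebraMap c
  | add p q hp hq => exact hQ.bounded_add hp hq
  | mul_X p i hp =>
    refine hQ.bounded_mul hp ?_
    obtain ⟨N, hN⟩ := h
    refine ⟨N, ?_⟩
    have hsum : ∀ s : Finset (Fin l ⊕ Fin T),
        ∑ j ∈ s, (MvPolynomial.X j : MvPolynomial (Fin l ⊕ Fin T) ℝ) ^ 2 ∈ certModule d lo hi := by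
      intro s
      induction s using Finset.induction_on with
      | empty => simpa using hQ.zero_mem
      | insert j s hj ih =>
        rw [Finset.sum_insert hj, sq]
        exact hQ.add_mem (hQ.sq_mem _) ih
    convert hQ.add_mem hN (hsum (Finset.univ.erase i)) using 1
    rw [← Finset.add_sum_erase _ _ (Finset.mem_univ i), MvPolynomial.algebraMap_eq]
    ring

/-- The set of pairs `(θ, α)` with `θ` in the box and `α ∈ S_{α,θ}`. -/
def feasiblePairs (d : Fin m → MvPolynomial (Fin l ⊕ Fin T) ℝ) (lo hi : Fin l → ℝ) :
    Set (Fin l ⊕ Fin T → ℝ) :=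
  {z | z ∘ Sum.inl ∈ Set.Icc lo hi ∧ z ∘ Sum.inr ∈ innerSet d (z ∘ Sum.inl)}

theorem eval_boxPoly (z : Fin l ⊕ Fin T → ℝ) (k : Fin l) :
    MvPolynomial.eval z (boxPoly lo hi k) = (hi k - z (.inl k)) * (z (.inl k) - lo k) := by
  simp [boxPoly]

theorem mem_feasiblePairs {z : Fin l ⊕ Fin T → ℝ} :
    z ∈ feasiblePairs d lo hi ↔
      z ∘ Sum.inl ∈ Set.Icc lo hi ∧ ∀ μ, 0 ≤ MvPolynomial.eval z (d μ) := by
  simp [feasiblePairs, innerSet, Sum.elim_comp_inl_inr]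

theorem elim_mem_feasiblePairs {θ : Fin l → ℝ} {α : Fin T → ℝ} (hθ : θ ∈ Set.Icc lo hi)
    (hα : α ∈ innerSet d θ) : Sum.elim θ α ∈ feasiblePairs d lo hi :=
  mem_feasiblePairs.2 ⟨by simpa using hθ, hα⟩

theorem _root_.IsSumSq.eval_nonneg {σ : Type*} {p : MvPolynomial σ ℝ} (hp : IsSumSq p)
    (z : σ → ℝ) : 0 ≤ MvPolynomial.eval z p := by
  induction hp with
  | zero => simp
  | sq_add a _ ih =>
    rw [map_add, map_mul]
    exact add_nonneg (mul_self_nonneg _) ih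

theorem eval_nonneg_of_mem_certModule {f : MvPolynomial (Fin l ⊕ Fin T) ℝ}
    (hf : f ∈ certModule d lo hi) {z : Fin l ⊕ Fin T → ℝ} (hz : z ∈ feasiblePairs d lo hi) :
    0 ≤ MvPolynomial.eval z f := by
  obtain ⟨s, σ, ψ, h1, h2, h3, rfl⟩ := hf
  rw [mem_feasiblePairs] at hz
  simp only [map_add, map_sum, map_mul, eval_boxPoly]
  refine add_nonneg (add_nonneg (h1.eval_nonneg z) ?_) ?_
  · exact Finset.sum_nonneg fun i _ => mul_nonneg ((h2 i).eval_nonneg z) (hz.2 i)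
  · exact Finset.sum_nonneg fun i _ => mul_nonneg ((h3 i).eval_nonneg z)
      (mul_nonneg (sub_nonneg.2 (hz.1.2 i)) (sub_nonneg.2 (hz.1.1 i)))

/-- Putinar's Positivstellensatz for the feasible pairs. -/
theorem mem_certModule_of_pos (h : IsArchimedeanModule d lo hi) (hbox : lo ≤ hi)
    {f : MvPolynomial (Fin l ⊕ Fin T) ℝ}
    (hf : ∀ z ∈ feasiblePairs d lo hi, 0 < MvPolynomial.eval z f) : f ∈ certModule d lo hi := by
  have hQ := isQuadraticModule_certModule d lo hi
  refine QuadraticModule.mem_of_forall_algHom_pos hQ (certModule_isArchimedean h) fun φ hφ => ?_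
  set z : Fin l ⊕ Fin T → ℝ := fun i => φ (MvPolynomial.X i) with hz
  have hev : ∀ p, φ p = MvPolynomial.eval z p := by
    intro p
    have : φ = MvPolynomial.aeval z := MvPolynomial.algHom_ext fun i => by simp [hz]
    rw [this]
    exact congrArg (fun f => f p) (MvPolynomial.coe_aeval_eq_eval z)
  rw [hev]
  refine hf z (mem_feasiblePairs.2 ⟨?_, fun μ => ?_⟩)
  -- Since `lo ≤ hi`, a nonnegative product rules out a negative factor.
  · have hk : ∀ k, 0 ≤ (hi k - z (.inl k)) * (z (.inl k) - lo k) := by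
      intro k
      rw [← eval_boxPoly, ← hev]
      exact hφ _ ⟨0, 0, Pi.single k 1, .zero, fun _ => .zero, fun j => by
        obtain rfl | hj := eq_or_ne j k
        · simp
        · simp [hj], by
        simp [Pi.single_apply]⟩
    exact ⟨fun k => by
      by_contra! hlt
      simp only [Function.comp_apply] at hlt
      nlinarith [hk k, hbox k], fun k => by
      by_contra! hlt
      simp only [Function.comp_apply] at hlt
      nlinarith [hk k, hbox k]⟩
  · rw [← hev]
    exact hφ _ ⟨0, Pi.single μ 1, 0, .zero, fun j => by
      obtain rfl | hj := eq_or_ne j μ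
      · simp
      · simp [hj], fun _ => .zero, by simp [Pi.single_apply]⟩

theorem isCompact_feasiblePairs (h : IsArchimedeanModule d lo hi) :
    IsCompact (feasiblePairs d lo hi) := by
  obtain ⟨N, hN⟩ := h
  have hc : IsCompact (Set.univ.pi fun _ : Fin l ⊕ Fin T =>
      Set.Icc (-Real.sqrt N) (Real.sqrt N)) := isCompact_univ_pi fun _ => isCompact_Icc
  refine hc.of_isClosed_subset ?_ fun z hz i _ => ?_
  · have : feasiblePairs d lo hi = (fun z => z ∘ Sum.inl) ⁻¹' Set.Icc lo hi ∩
        ⋂ μ, {z | 0 ≤ MvPolynomial.eval z (d μ)} := by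
      ext z
      simp [mem_feasiblePairs]
    rw [this]
    refine (isClosed_Icc.preimage (by fun_prop)).inter ?_
    exact isClosed_iInter fun μ => isClosed_le continuous_const (MvPolynomial.continuous_eval _)
  · have h1 := eval_nonneg_of_mem_certModule hN hz
    simp only [map_sub, map_sum, map_pow, MvPolynomial.eval_X, MvPolynomial.eval_C] at h1
    have h2 := Finset.single_le_sum (f := fun i => z i ^ 2) (fun i _ => sq_nonneg (z i))
      (Finset.mem_univ i)
    exact abs_le.1 (Real.abs_le_sqrt (by linarith))

/-! ### The optimal value function and its polynomial majorants -/

/-- The inner maxima are attained on the box. -/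
theorem isGreatest_valueFn (h : IsArchimedeanModule d lo hi)
    {θ : Fin l → ℝ} (hθ : θ ∈ Set.Icc lo hi) (hne : (innerSet d θ).Nonempty) :
    IsGreatest (innerValues J d θ) (valueFn J d θ) := by
  have hK : IsCompact (feasiblePairs d lo hi ∩ (fun z => z ∘ Sum.inl) ⁻¹' {θ}) :=
    (isCompact_feasiblePairs h).inter_right (isClosed_singleton.preimage (by fun_prop))
  have e : innerValues J d θ = (fun z => MvPolynomial.eval z J) ''
      (feasiblePairs d lo hi ∩ (fun z => z ∘ Sum.inl) ⁻¹' {θ}) := by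
    ext x
    constructor
    · rintro ⟨α, hα, rfl⟩
      exact ⟨Sum.elim θ α, ⟨elim_mem_feasiblePairs hθ hα, by simp⟩, rfl⟩
    · rintro ⟨z, ⟨hz, hzθ⟩, rfl⟩
      obtain rfl : z ∘ Sum.inl = θ := hzθ
      exact ⟨z ∘ Sum.inr, hz.2, by simp [Sum.elim_comp_inl_inr]⟩
  refine IsCompact.isGreatest_sSup ?_ (hne.image _)
  rw [e]
  exact hK.image (MvPolynomial.continuous_eval J)

theorem eval_le_valueFn (h : IsArchimedeanModule d lo hi) {z : Fin l ⊕ Fin T → ℝ}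
    (hz : z ∈ feasiblePairs d lo hi) : MvPolynomial.eval z J ≤ valueFn J d (z ∘ Sum.inl) :=
  (isGreatest_valueFn h hz.1 ⟨_, hz.2⟩).2 ⟨z ∘ Sum.inr, hz.2, by simp [Sum.elim_comp_inl_inr]⟩

theorem exists_eval_eq_valueFn (h : IsArchimedeanModule d lo hi)
    {θ : Fin l → ℝ} (hθ : θ ∈ Set.Icc lo hi) (hne : (innerSet d θ).Nonempty) :
    ∃ z ∈ feasiblePairs d lo hi, z ∘ Sum.inl = θ ∧ MvPolynomial.eval z J = valueFn J d θ := by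
  obtain ⟨α, hα, h1⟩ := (isGreatest_valueFn (J := J) h hθ hne).1
  exact ⟨_, elim_mem_feasiblePairs hθ hα, by simp, h1⟩

/-- The optimal value function is upper semicontinuous on the box. -/
theorem exists_ball_valueFn_lt (h : IsArchimedeanModule d lo hi)
    (hS : ∀ θ ∈ Set.Icc lo hi, (innerSet d θ).Nonempty) {θ₀ : Fin l → ℝ} {c : ℝ}
    (hc : valueFn J d θ₀ < c) :
    ∃ r > 0, ∀ θ ∈ Set.Icc lo hi, dist θ θ₀ < r → valueFn J d θ < c := by
  -- The projection of this compact superlevel set is closed and misses θ₀.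
  have hK : IsCompact (feasiblePairs d lo hi ∩ {z | c ≤ MvPolynomial.eval z J}) :=
    (isCompact_feasiblePairs h).inter_right
      (isClosed_le continuous_const (MvPolynomial.continuous_eval J))
  have hcl := (hK.image (f := fun z => z ∘ Sum.inl) (by fun_prop)).isClosed
  have hmem : θ₀ ∈ ((fun z => z ∘ Sum.inl) ''
      (feasiblePairs d lo hi ∩ {z | c ≤ MvPolynomial.eval z J}))ᶜ := by
    rintro ⟨z, ⟨hz, hzc⟩, rfl⟩
    exact absurd (eval_le_valueFn (J := J) h hz) (not_le.2 (hc.trans_le hzc))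
  obtain ⟨r, hr, hball⟩ := Metric.isOpen_iff.1 hcl.isOpen_compl θ₀ hmem
  refine ⟨r, hr, fun θ hθ hd => ?_⟩
  obtain ⟨z, hz, rfl, hzv⟩ := exists_eval_eq_valueFn (J := J) h hθ (hS θ hθ)
  by_contra! hle
  exact hball hd ⟨z, ⟨hz, hle.trans_eq hzv.symm⟩, rfl⟩

theorem exists_le_valueFn (h : IsArchimedeanModule d lo hi)
    (hS : ∀ θ ∈ Set.Icc lo hi, (innerSet d θ).Nonempty) :
    ∃ B, ∀ θ ∈ Set.Icc lo hi, B ≤ valueFn J d θ := by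
  obtain ⟨B, hB⟩ := (isCompact_feasiblePairs h).bddBelow_image
    (MvPolynomial.continuous_eval J).continuousOn
  refine ⟨B, fun θ hθ => ?_⟩
  obtain ⟨z, hz, -, hzv⟩ := exists_eval_eq_valueFn (J := J) h hθ (hS θ hθ)
  exact (hB ⟨z, hz, rfl⟩).trans_eq hzv

theorem eval_rename_inl_sub (p : MvPolynomial (Fin l) ℝ) (z : Fin l ⊕ Fin T → ℝ) :
    MvPolynomial.eval z (MvPolynomial.rename Sum.inl p - J) =
      MvPolynomial.eval (z ∘ Sum.inl) p - MvPolynomial.eval z J := by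
  rw [map_sub, MvPolynomial.eval_rename]

theorem IsFeasible.valueFn_le (h : IsArchimedeanModule d lo hi)
    (hS : ∀ θ ∈ Set.Icc lo hi, (innerSet d θ).Nonempty) {τ : ℕ} {p : MvPolynomial (Fin l) ℝ}
    (hp : IsFeasible J d lo hi τ p) {θ : Fin l → ℝ} (hθ : θ ∈ Set.Icc lo hi) :
    valueFn J d θ ≤ MvPolynomial.eval θ p := by
  obtain ⟨z, hz, rfl, hzv⟩ := exists_eval_eq_valueFn (J := J) h hθ (hS θ hθ)
  obtain ⟨-, σ₀, σ, ψ, hcert, -⟩ := hp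
  have := eval_nonneg_of_mem_certModule ⟨σ₀, σ, ψ, hcert⟩ hz
  rw [eval_rename_inl_sub] at this
  linarith

/-- A polynomial strictly above the optimal value function is feasible for large orders. -/
theorem exists_forall_isFeasible (h : IsArchimedeanModule d lo hi) (hbox : lo ≤ hi)
    {p : MvPolynomial (Fin l) ℝ}
    (hp : ∀ θ ∈ Set.Icc lo hi, valueFn J d θ < MvPolynomial.eval θ p) :
    ∃ τ₁, ∀ τ, τ₁ ≤ τ → IsFeasible J d lo hi τ p := by
  obtain ⟨σ₀, σ, ψ, hcert⟩ := mem_certModule_of_pos h hbox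
    (f := MvPolynomial.rename Sum.inl p - J) fun z hz => by
      rw [eval_rename_inl_sub, sub_pos]
      exact (eval_le_valueFn h hz).trans_lt (hp _ hz.1)
  refine ⟨p.totalDegree + σ₀.totalDegree + ∑ μ, (σ μ * d μ).totalDegree +
    ∑ k, (ψ k * boxPoly lo hi k).totalDegree, fun τ hτ => ⟨by omega, σ₀, σ, ψ, hcert, by omega,
      fun μ => ?_, fun k => ?_⟩⟩
  · have := Finset.single_le_sum (f := fun μ => (σ μ * d μ).totalDegree)
      (fun _ _ => Nat.zero_le _) (Finset.mem_univ μ)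
    omega
  · have := Finset.single_le_sum (f := fun k => (ψ k * boxPoly lo hi k).totalDegree)
      (fun _ _ => Nat.zero_le _) (Finset.mem_univ k)
    omega

/-! ### Means over the box, approximation and lowering of majorants -/

theorem isProbabilityMeasure_uniformBox (hvol : volume (Set.Icc lo hi) ≠ 0) :
    IsProbabilityMeasure (uniformBox lo hi) :=
  ProbabilityTheory.cond_isProbabilityMeasure_of_finite hvol isCompact_Icc.measure_ne_top

theorem integrable_uniformBox (hvol : volume (Set.Icc lo hi) ≠ 0) {f : (Fin l → ℝ) → ℝ}
    (hf : Continuous f) : Integrable f (uniformBox lo hi) :=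
  Integrable.smul_measure (hf.continuousOn.integrableOn_compact isCompact_Icc)
    (ENNReal.inv_ne_top.2 hvol)

theorem ae_uniformBox_mem : ∀ᵐ θ ∂(uniformBox lo hi), θ ∈ Set.Icc lo hi :=
  Measure.ae_smul_measure (ae_restrict_mem measurableSet_Icc) _

theorem objective_eq_integral (hvol : volume (Set.Icc lo hi) ≠ 0) (p : MvPolynomial (Fin l) ℝ) :
    objective lo hi p = ∫ θ, MvPolynomial.eval θ p ∂(uniformBox lo hi) := by
  simp only [MvPolynomial.eval_eq']
  rw [integral_finsetSum]
  · simp only [integral_const_mul, objective, boxMoment]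
  · exact fun β _ => integrable_uniformBox hvol (by fun_prop)

theorem exists_polynomial_near {K : Set (Fin l → ℝ)} (hK : IsCompact K) {q : (Fin l → ℝ) → ℝ}
    (hq : Continuous q) {η : ℝ} (hη : 0 < η) :
    ∃ p : MvPolynomial (Fin l) ℝ, ∀ θ ∈ K, |MvPolynomial.eval θ p - q θ| < η := by
  let X : Fin l → C(Fin l → ℝ, ℝ) := fun i => ⟨fun θ => θ i, continuous_apply i⟩
  have hev : ∀ p θ, MvPolynomial.aeval X p θ = MvPolynomial.eval θ p := by
    intro p θ
    induction p using MvPolynomial.induction_on with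
    | C c => simp
    | add p q hp hq => simp [hp, hq]
    | mul_X p i hp => simp [hp, X]
  have hsep : (MvPolynomial.aeval (R := ℝ) X).range.SeparatesPoints := by
    intro x y hxy
    obtain ⟨i, hi⟩ := Function.ne_iff.1 hxy
    exact ⟨_, ⟨X i, ⟨MvPolynomial.X i, by simp⟩, rfl⟩, hi⟩
  obtain ⟨_, ⟨p, rfl⟩, hp⟩ :=
    ContinuousMap.exists_mem_subalgebra_near_continuous_of_isCompact_of_separatesPoints hsep
      ⟨q, hq⟩ hK hη
  refine ⟨p, fun θ hθ => ?_⟩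
  have := hp θ hθ
  rw [Real.norm_eq_abs] at this
  change |MvPolynomial.aeval X p θ - q θ| < η at this
  rwa [hev] at this

/-- A majorant of `V` on the box that exceeds `c + ε` on `M`, where `V < c` near a point of `M`,
can be lowered to another majorant whose integral drops by a fixed amount. -/
theorem exists_forall_exists_lower_majorant {M : Set (Fin l → ℝ)} (hMc : IsCompact M)
    (hMbox : M ⊆ Set.Icc lo hi)
    (hMpos : ∀ U : Set (Fin l → ℝ), IsOpen U → (M ∩ U).Nonempty → 0 < volume (M ∩ U))
    {V : (Fin l → ℝ) → ℝ} {c ε r : ℝ} (hε : 0 < ε) (hr : 0 < r) {θ₀ : Fin l → ℝ} (hθ₀ : θ₀ ∈ M)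
    (hV : ∀ θ ∈ Set.Icc lo hi, dist θ θ₀ < r → V θ < c) :
    ∃ δ > 0, ∀ p : (Fin l → ℝ) → ℝ, Continuous p → (∀ θ ∈ Set.Icc lo hi, V θ ≤ p θ) →
      (∀ θ ∈ M, c + ε ≤ p θ) → ∃ q : (Fin l → ℝ) → ℝ, Continuous q ∧
        (∀ θ ∈ Set.Icc lo hi, V θ ≤ q θ) ∧
        ∫ θ, q θ ∂(uniformBox lo hi) ≤ ∫ θ, p θ ∂(uniformBox lo hi) - δ := by
  have hbpos := hMpos (Metric.ball θ₀ (r / 2)) Metric.isOpen_ball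
    ⟨θ₀, hθ₀, Metric.mem_ball_self (by linarith)⟩
  set S := M ∩ Metric.ball θ₀ (r / 2) with hSdef
  have hSbox : S ⊆ Set.Icc lo hi := Set.inter_subset_left.trans hMbox
  have hSm : MeasurableSet S := hMc.measurableSet.inter Metric.isOpen_ball.measurableSet
  have hvol : volume (Set.Icc lo hi) ≠ 0 := (hbpos.trans_le (measure_mono hSbox)).ne'
  have hprob := isProbabilityMeasure_uniformBox hvol
  have hSpos : 0 < (uniformBox lo hi).real S := by
    refine ENNReal.toReal_pos ?_ (measure_ne_top _ _)
    rw [uniformBox, ProbabilityTheory.cond_apply measurableSet_Icc,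
      Set.inter_eq_right.2 hSbox]
    exact mul_ne_zero (ENNReal.inv_ne_zero.2 isCompact_Icc.measure_ne_top) hbpos.ne'
  -- On S the bump is at least 1/2 and p - c at least ε, whatever p is.
  refine ⟨ε / 2 * (uniformBox lo hi).real S, by positivity, fun p hp hVp hMp => ?_⟩
  -- A bump with values in [0, 1], vanishing off the r-ball. Subtracting b (p - c)⁺ never pushes p
  -- from above c to below it, and V < c on that ball.
  let b : (Fin l → ℝ) → ℝ := fun θ => max 0 (1 - dist θ θ₀ / r)
  have hb : Continuous b := by fun_prop
  have hg : Continuous fun θ => b θ * max (p θ - c) 0 := by fun_prop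
  have hb0 : ∀ θ, 0 ≤ b θ := fun θ => le_max_left _ _
  refine ⟨fun θ => p θ - b θ * max (p θ - c) 0, hp.sub hg, fun θ hθ => ?_, ?_⟩
  · have hb1 : b θ ≤ 1 := max_le zero_le_one (sub_le_self _ (by positivity))
    change V θ ≤ p θ - b θ * max (p θ - c) 0
    by_cases hd : dist θ θ₀ < r
    · have h1 := hV θ hθ hd
      rcases le_total (p θ) c with h2 | h2
      · rw [max_eq_right (by linarith), mul_zero, sub_zero]
        exact hVp θ hθ
      · rw [max_eq_left (by linarith)]
        nlinarith
    · have : b θ = 0 := max_eq_left (by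
        have := (one_le_div hr).2 (not_lt.1 hd)
        linarith)
      rw [this, zero_mul, sub_zero]
      exact hVp θ hθ
  · rw [integral_sub (integrable_uniformBox hvol hp) (integrable_uniformBox hvol hg)]
    have h1 : ∫ θ, S.indicator (fun _ => ε / 2) θ ∂(uniformBox lo hi) ≤
        ∫ θ, b θ * max (p θ - c) 0 ∂(uniformBox lo hi) := by
      refine integral_mono ((integrable_const _).indicator hSm) (integrable_uniformBox hvol hg)
        fun θ => ?_
      by_cases hθ : θ ∈ S
      · rw [Set.indicator_of_mem hθ]
        have hb2 : 1 / 2 ≤ b θ := by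
          refine le_trans ?_ (le_max_right _ _)
          have : dist θ θ₀ / r ≤ 1 / 2 := by
            rw [div_le_iff₀ hr]
            linarith [Metric.mem_ball.1 hθ.2]
          linarith
        have hm : ε ≤ max (p θ - c) 0 := le_max_of_le_left (by linarith [hMp θ hθ.1])
        change ε / 2 ≤ b θ * max (p θ - c) 0
        nlinarith
      · rw [Set.indicator_of_notMem hθ]
        exact mul_nonneg (hb0 θ) (le_max_right _ _)
    rw [integral_indicator_const _ hSm, smul_eq_mul] at h1
    linarith

/-! ### Minimization over M and convergence -/

theorem optValue_eq_of_mem_minimizers {A : Set (Fin l → ℝ)} {f : (Fin l → ℝ) → ℝ} {θ : Fin l → ℝ}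
    (h : θ ∈ minimizers A f) : optValue A f = f θ :=
  IsLeast.csInf_eq ⟨⟨θ, h.1, rfl⟩, by
    rintro _ ⟨θ', hθ', rfl⟩
    exact h.2 θ' hθ'⟩

theorem minimizers_eval_nonempty {M : Set (Fin l → ℝ)} (hMc : IsCompact M) (hMne : M.Nonempty)
    (p : MvPolynomial (Fin l) ℝ) :
    (minimizers M (fun θ => MvPolynomial.eval θ p)).Nonempty := by
  obtain ⟨θ, hθ, hmin⟩ := hMc.exists_isMinOn hMne (MvPolynomial.continuous_eval p).continuousOn
  exact ⟨θ, hθ, fun θ' hθ' => hmin hθ'⟩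

/-- Some relaxation has an optimal value over `M` that is `ε`-close to the min-max value. -/
theorem exists_polyOptValue_lt {M : Set (Fin l → ℝ)}
    (hMc : IsCompact M) (hMne : M.Nonempty) (hMbox : M ⊆ Set.Icc lo hi)
    (hMpos : ∀ U : Set (Fin l → ℝ), IsOpen U → (M ∩ U).Nonempty → 0 < volume (M ∩ U))
    (hS : ∀ θ ∈ Set.Icc lo hi, (innerSet d θ).Nonempty)
    (hArch : IsArchimedeanModule d lo hi) {τ₀ : ℕ} {P : ℕ → MvPolynomial (Fin l) ℝ}
    (hP : ∀ τ, τ₀ ≤ τ → IsOptimal J d lo hi τ (P τ)) {ε : ℝ} (hε : 0 < ε) :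
    ∃ k, τ₀ ≤ k ∧ polyOptValue M P k < optValue M (valueFn J d) + ε := by
  by_contra! hcon
  have hbox : lo ≤ hi := by
    obtain ⟨θ, hθ⟩ := hMne
    exact (hMbox hθ).1.trans (hMbox hθ).2
  have hvol : volume (Set.Icc lo hi) ≠ 0 := by
    have := hMpos Set.univ isOpen_univ (by simpa using hMne)
    rw [Set.inter_univ] at this
    exact (this.trans_le (measure_mono hMbox)).ne'
  have hprob := isProbabilityMeasure_uniformBox hvol
  obtain ⟨_, ⟨θ₀, hθ₀, rfl⟩, hθ₀lt⟩ := exists_lt_of_csInf_lt (hMne.image (valueFn J d))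
    (lt_add_of_pos_right (optValue M (valueFn J d)) (half_pos hε))
  obtain ⟨r, hr, hV⟩ := exists_ball_valueFn_lt hArch hS hθ₀lt
  obtain ⟨δ, hδ, hlow⟩ := exists_forall_exists_lower_majorant hMc hMbox hMpos (half_pos hε) hr
    hθ₀ hV
  have hmaj : ∀ k, τ₀ ≤ k → ∀ θ ∈ Set.Icc lo hi, valueFn J d θ ≤ MvPolynomial.eval θ (P k) :=
    fun k hk θ hθ => (hP k hk).1.valueFn_le hArch hS hθ
  obtain ⟨B, hB⟩ := exists_le_valueFn (J := J) hArch hS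
  have hbdd : BddBelow ((fun k => objective lo hi (P k)) '' Set.Ici τ₀) := by
    refine ⟨B, ?_⟩
    rintro _ ⟨k, hk, rfl⟩
    simp only [objective_eq_integral hvol]
    calc B = ∫ _, B ∂(uniformBox lo hi) := by simp
      _ ≤ _ := integral_mono_ae (integrable_const B)
        (integrable_uniformBox hvol (MvPolynomial.continuous_eval _))
        (ae_uniformBox_mem.mono fun θ hθ => (hB θ hθ).trans (hmaj k hk θ hθ))
  obtain ⟨_, ⟨k, hk, rfl⟩, hklt⟩ := exists_lt_of_csInf_lt (Set.nonempty_Ici.image _)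
    (lt_add_of_pos_right (sInf ((fun k => objective lo hi (P k)) '' Set.Ici τ₀)) (half_pos hδ))
  obtain ⟨q, hq, hVq, hqint⟩ := hlow (fun θ => MvPolynomial.eval θ (P k))
    (MvPolynomial.continuous_eval _) (hmaj k hk) (fun θ hθ => by
      obtain ⟨θ', hθ'⟩ := minimizers_eval_nonempty hMc hMne (P k)
      have h1 := hcon k hk
      rw [polyOptValue, optValue_eq_of_mem_minimizers hθ'] at h1
      linarith [hθ'.2 θ hθ])
  -- The shift δ/4 with error below δ/4 puts p strictly above q, as Putinar's theorem demands, and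
  -- raises the mean by at most δ/2.
  obtain ⟨p, hp⟩ : ∃ p : MvPolynomial (Fin l) ℝ, ∀ θ ∈ Set.Icc lo hi,
      |MvPolynomial.eval θ p - (q θ + δ / 4)| < δ / 4 :=
    exists_polynomial_near isCompact_Icc (hq.add continuous_const) (by linarith)
  obtain ⟨τ₁, hτ₁⟩ := exists_forall_isFeasible (J := J) (p := p) hArch hbox fun θ hθ => by
    linarith [(abs_lt.1 (hp θ hθ)).1, hVq θ hθ]
  have hpint : ∫ θ, MvPolynomial.eval θ p ∂(uniformBox lo hi) ≤
      ∫ θ, (q θ + δ / 2) ∂(uniformBox lo hi) :=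
    integral_mono_ae (integrable_uniformBox hvol (MvPolynomial.continuous_eval _))
      (integrable_uniformBox hvol (hq.add continuous_const))
      (ae_uniformBox_mem.mono fun θ hθ => by
        have := (abs_lt.1 (hp θ hθ)).2
        simp only
        linarith)
  rw [integral_add (integrable_uniformBox hvol hq) (integrable_const _)] at hpint
  simp only [integral_const, probReal_univ, one_smul] at hpint
  -- The optimal value at this order is at most mean(q) + δ/2 ≤ mean(P k) - δ/2, which is below the
  -- infimum.
  have h1 := (hP (max τ₀ τ₁) (le_max_left _ _)).2 p (hτ₁ _ (le_max_right _ _))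
  have h2 := csInf_le hbdd ⟨max τ₀ τ₁, Set.mem_Ici.2 (le_max_left _ _), rfl⟩
  simp only [objective_eq_integral hvol] at h1 h2 hklt
  linarith

end RobustSM

end

theorem theorem2 {l T m : ℕ}
    (J : MvPolynomial (Fin l ⊕ Fin T) ℝ)
    (d : Fin m → MvPolynomial (Fin l ⊕ Fin T) ℝ)
    (M : Set (Fin l → ℝ)) (lo hi : Fin l → ℝ)
    (hMc : IsCompact M) (hMne : M.Nonempty) (hMbox : M ⊆ Set.Icc lo hi)
    (hMpos : ∀ U : Set (Fin l → ℝ), IsOpen U → (M ∩ U).Nonempty → 0 < volume (M ∩ U))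
    (hS : ∀ θ ∈ Set.Icc lo hi, (RobustSM.innerSet d θ).Nonempty)
    (hArch : RobustSM.IsArchimedeanModule d lo hi)
    (τ₀ : ℕ) (P : ℕ → MvPolynomial (Fin l) ℝ)
    (hP : ∀ τ, τ₀ ≤ τ → RobustSM.IsOptimal J d lo hi τ (P τ)) :
    -- the inner maxima are attained, and the min-max value is a genuine infimum
    (∀ θ ∈ Set.Icc lo hi,
      IsGreatest (RobustSM.innerValues J d θ) (RobustSM.valueFn J d θ)) ∧
    IsGLB (RobustSM.valueFn J d '' M) (RobustSM.optValue M (RobustSM.valueFn J d)) ∧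
    -- the polynomial problems have optimal solutions
    (∀ τ, (RobustSM.minimizers M (fun θ => MvPolynomial.eval θ (P τ))).Nonempty) ∧
    -- the best value so far converges to the min-max value
    Tendsto (fun τ => RobustSM.bestValue M P τ₀ τ) atTop
      (𝓝 (RobustSM.optValue M (RobustSM.valueFn J d))) ∧
    -- for every choice of the minimizers and of the indices of the best values so far
    (∀ (θs : ℕ → Fin l → ℝ) (k : ℕ → ℕ),
      (∀ τ, τ₀ ≤ τ →
        θs τ ∈ RobustSM.minimizers M (fun θ => MvPolynomial.eval θ (P τ))) →
      (∀ τ, τ₀ ≤ τ → k τ ∈ Set.Icc τ₀ τ ∧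
        RobustSM.polyOptValue M P (k τ) = RobustSM.bestValue M P τ₀ τ) →
      Tendsto (fun τ => MvPolynomial.eval (θs (k τ)) (P (k τ))) atTop
        (𝓝 (RobustSM.optValue M (RobustSM.valueFn J d))) ∧
      (ContinuousOn (RobustSM.valueFn J d) M →
        (∀ θbar, MapClusterPt θbar atTop (fun τ => θs (k τ)) →
          θbar ∈ RobustSM.minimizers M (RobustSM.valueFn J d)) ∧
        (∀ θrob, RobustSM.minimizers M (RobustSM.valueFn J d) = {θrob} →
          Tendsto (fun τ => θs (k τ)) atTop (𝓝 θrob)))) := by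
  have hmaj : ∀ τ, τ₀ ≤ τ → ∀ θ ∈ M, RobustSM.valueFn J d θ ≤ MvPolynomial.eval θ (P τ) :=
    fun τ hτ θ hθ => (hP τ hτ).1.valueFn_le hArch hS (hMbox hθ)
  obtain ⟨B, hB⟩ := RobustSM.exists_le_valueFn (J := J) hArch hS
  have hbdd : BddBelow (RobustSM.valueFn J d '' M) := ⟨B, by
    rintro _ ⟨θ, hθ, rfl⟩
    exact hB θ (hMbox hθ)⟩
  have hglb : IsGLB (RobustSM.valueFn J d '' M) (RobustSM.optValue M (RobustSM.valueFn J d)) :=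
    isGLB_csInf (hMne.image _) hbdd
  have hmin := fun τ => RobustSM.minimizers_eval_nonempty hMc hMne (P τ)
  have hle : ∀ τ, τ₀ ≤ τ →
      RobustSM.optValue M (RobustSM.valueFn J d) ≤ RobustSM.polyOptValue M P τ := by
    intro τ hτ
    obtain ⟨θ, hθ⟩ := hmin τ
    rw [RobustSM.polyOptValue, RobustSM.optValue_eq_of_mem_minimizers hθ]
    exact (hglb.1 ⟨θ, hθ.1, rfl⟩).trans (hmaj τ hτ θ hθ.1)
  have hbest : Tendsto (fun τ => RobustSM.bestValue M P τ₀ τ) atTop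
      (𝓝 (RobustSM.optValue M (RobustSM.valueFn J d))) := by
    refine tendsto_order.2 ⟨fun a ha => ?_, fun a ha => ?_⟩
    · filter_upwards [eventually_ge_atTop τ₀] with τ hτ
      refine ha.trans_le (le_csInf (Set.Nonempty.image _ ⟨τ₀, le_rfl, hτ⟩) ?_)
      rintro _ ⟨k, hk, rfl⟩
      exact hle k hk.1
    · obtain ⟨k, hk, hka⟩ := RobustSM.exists_polyOptValue_lt hMc hMne hMbox hMpos hS hArch hP
        (sub_pos.2 ha)
      filter_upwards [eventually_ge_atTop k] with τ hτ
      rw [add_sub_cancel] at hka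
      exact (csInf_le ((Set.finite_Icc τ₀ τ).image _).bddBelow ⟨k, ⟨hk, hτ⟩, rfl⟩).trans_lt hka
  refine ⟨fun θ hθ => RobustSM.isGreatest_valueFn hArch hθ (hS θ hθ), hglb, hmin, hbest,
    fun θs k hθs hk => ?_⟩
  have heval : Tendsto (fun τ => MvPolynomial.eval (θs (k τ)) (P (k τ))) atTop
      (𝓝 (RobustSM.optValue M (RobustSM.valueFn J d))) := by
    refine hbest.congr' ?_
    filter_upwards [eventually_ge_atTop τ₀] with τ hτ
    rw [← (hk τ hτ).2, RobustSM.polyOptValue,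
      RobustSM.optValue_eq_of_mem_minimizers (hθs (k τ) (hk τ hτ).1.1)]
  have hmemM : ∀ᶠ τ in atTop, θs (k τ) ∈ M := by
    filter_upwards [eventually_ge_atTop τ₀] with τ hτ using (hθs (k τ) (hk τ hτ).1.1).1
  -- J̃ at the chosen minimizers is squeezed between J* and the polynomial values.
  have hval : Tendsto (fun τ => RobustSM.valueFn J d (θs (k τ))) atTop
      (𝓝 (RobustSM.optValue M (RobustSM.valueFn J d))) := by
    refine tendsto_of_tendsto_of_tendsto_of_le_of_le' tendsto_const_nhds heval ?_ ?_
    · filter_upwards [hmemM] with τ hτ using hglb.1 ⟨_, hτ, rfl⟩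
    · filter_upwards [eventually_ge_atTop τ₀] with τ hτ
      exact hmaj _ (hk τ hτ).1.1 _ (hθs (k τ) (hk τ hτ).1.1).1
  refine ⟨heval, fun hcont => ?_⟩
  have hclus : ∀ θbar, MapClusterPt θbar atTop (fun τ => θs (k τ)) →
      θbar ∈ RobustSM.minimizers M (RobustSM.valueFn J d) := by
    intro θbar hbar
    have hM : θbar ∈ M := hMc.isClosed.mem_of_mapClusterPt hbar hmemM
    refine ⟨hM, fun θ' hθ' => ?_⟩
    -- Along an ultrafilter converging to the cluster point, continuity on M identifies J̃(θbar)
    -- with J*.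
    obtain ⟨U, hU, hUlim⟩ := mapClusterPt_iff_ultrafilter.1 hbar
    have h1 : Tendsto (fun τ => θs (k τ)) U (𝓝[M] θbar) :=
      tendsto_nhdsWithin_iff.2 ⟨hUlim, hU hmemM⟩
    have h2 := tendsto_nhds_unique ((hcont θbar hM).tendsto.comp h1) (hval.mono_left hU)
    rw [h2]
    exact hglb.1 ⟨θ', hθ', rfl⟩
  refine ⟨hclus, fun θrob hrob => hMc.tendsto_nhds_of_unique_mapClusterPt hmemM fun θ _ hθ => ?_⟩
  have := hclus θ hθ
  rwa [hrob, Set.mem_singleton_iff] at this
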